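/- Let $n,m\ge 1$. A weight on $\mathbb R^n$ is a measurable function $w:\mathbb R^n\to\mathbb R$ with $w>0$ almost everywhere (local integrability is not assumed). All cubes $Q$ have sides parallel to the coordinate axes, $|Q|$ is the Lebesgue measure of $Q$, and $q'=q/(q-1)$. For $1<q<\infty$ a weight $w$ belongs to $A_q$ if $$\sup_Q\Big(\frac1{|Q|}\int_Q w\,dx\Big)\Big(\frac1{|Q|}\int_Q w^{1-q'}\,dx\Big)^{q-1}<\infty ,$$ and $A_\infty=\bigcup_{1<q<\infty}A_q$. Given $\vec p=(p_1,\dots,p_m)$ with $1<p_i<\infty$, let $\frac1p=\sum_{i=1}^m\frac1{p_i}$; a vector of weights $\vec w=(w_1,\dots,w_m)$ belongs to $A_{\vec p}$ if $$\sup_Q\Big(\frac1{|Q|}\int_Q \prod_{i=1}^m w_i^{p/p_i}\,dx\Big)^{1/p}\prod_{i=1}^m\Big(\frac1{|Q|}\int_Q w_i^{1-p_i'}\,dx\Big)^{1/p_i'}<\infty ,$$ and it is a product $A_{\vec p}$ weight if $w_i\in A_{p_i}$ for every $i$. (a) If $1<p_1,\dots,p_m<\infty$, $\vec w\in A_{\vec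 p}$ and $w_i\in A_\infty$ for every $i$, then $w_i\in A_{p_i}$ for every $i$; that is, $\vec w$ is a product $A_{\vec p}$ weight. (b) In (a) the hypothesis $w_i\in A_\infty$ cannot be weakened to $w_i\in L^1_{\mathrm{loc}}$: on $\mathbb R$, let $$w_1(x)=\frac{1}{|x|\,(\log(e/|x|))^2}\ \text{ for } 0<|x|\le 1,\qquad w_1(x)=1\ \text{ for } |x|>1,\qquad w_2\equiv 1 .$$ Then for all $1<p_1,p_2<\infty$ we have $(w_1,w_2)\in A_{(p_1,p_2)}$ and $w_1,w_2\in L^1_{\mathrm{loc}}(\mathbb R)$, but $w_1\notin A_\infty$ and $w_1\notin A_{p_1}$, so that $(w_1,w_2)$ is not a product weight. -/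

import Mathlib

open MeasureTheory
open scoped ENNReal

noncomputable section

namespace Muckenhoupt

/-- The closed cube in `ℝⁿ` with sides parallel to the axes, lower corner `a` and side length `h`. -/
def cube {n : ℕ} (a : Fin n → ℝ) (h : ℝ) : Set (Fin n → ℝ) :=
  Set.Icc a (fun j => a j + h)

/-- A weight: a Lebesgue measurable function on `ℝⁿ`, positive almost everywhere.
Local integrability is not required. -/
def IsWeight {n : ℕ} (w : (Fin n → ℝ) → ℝ) : Prop :=
  AEMeasurable w volume ∧ ∀ᵐ x ∂(volume : Measure (Fin n → ℝ)), 0 < w x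

/-- The average of a nonnegative function over a cube, possibly infinite. -/
def cubeAvg {n : ℕ} (a : Fin n → ℝ) (h : ℝ) (f : (Fin n → ℝ) → ℝ) : ℝ≥0∞ :=
  ⨍⁻ x in cube a h, ENNReal.ofReal (f x) ∂volume

/-- The characteristic `[w]_{A_p}`; here `Real.conjExponent p = p / (p - 1)` is `p'`. -/
def apConst {n : ℕ} (p : ℝ) (w : (Fin n → ℝ) → ℝ) : ℝ≥0∞ :=
  ⨆ (a : Fin n → ℝ) (h : ℝ) (_ : 0 < h),
    cubeAvg a h w * cubeAvg a h (fun x => w x ^ (1 - Real.conjExponent p)) ^ (p - 1)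

/-- The class `A_p` for `1 < p < ∞`. -/
def IsAp {n : ℕ} (p : ℝ) (w : (Fin n → ℝ) → ℝ) : Prop :=
  IsWeight w ∧ apConst p w < ∞

/-- The class `A_∞`, the union of the classes `A_q`, `1 < q < ∞`. -/
def IsAinfty {n : ℕ} (w : (Fin n → ℝ) → ℝ) : Prop :=
  ∃ q : ℝ, 1 < q ∧ IsAp q w

/-- The exponent `p` with `1 / p = ∑ i, 1 / p_i`. -/
def totalExponent {m : ℕ} (p : Fin m → ℝ) : ℝ :=
  (∑ i, 1 / p i)⁻¹

/-- The weight `w = ∏ i, w_i ^ (p / p_i)`. -/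
def prodWeight {n m : ℕ} (p : Fin m → ℝ) (w : Fin m → (Fin n → ℝ) → ℝ) :
    (Fin n → ℝ) → ℝ :=
  fun x => ∏ i, w i x ^ (totalExponent p / p i)

/-- The characteristic of the multilinear class `A_{(p_1, …, p_m)}`. -/
def multiApConst {n m : ℕ} (p : Fin m → ℝ) (w : Fin m → (Fin n → ℝ) → ℝ) : ℝ≥0∞ :=
  ⨆ (a : Fin n → ℝ) (h : ℝ) (_ : 0 < h),
    cubeAvg a h (prodWeight p w) ^ (1 / totalExponent p) *
      ∏ i, cubeAvg a h (fun x => w i x ^ (1 - Real.conjExponent (p i))) ^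
        (1 / Real.conjExponent (p i))

/-- The multilinear class `A_{(p_1, …, p_m)}`. -/
def IsMultiAp {n m : ℕ} (p : Fin m → ℝ) (w : Fin m → (Fin n → ℝ) → ℝ) : Prop :=
  (∀ i, IsWeight (w i)) ∧ multiApConst p w < ∞

/-- Product weights: each `w_i` lies in `A_{p_i}`. -/
def IsProductAp {n m : ℕ} (p : Fin m → ℝ) (w : Fin m → (Fin n → ℝ) → ℝ) : Prop :=
  ∀ i, IsAp (p i) (w i)

/-- The weight on `ℝ` equal to `1 / (|x| log(e / |x|)²)` on `[-1, 1]` and to `1` elsewhere. -/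
def logWeight : (Fin 1 → ℝ) → ℝ := fun x =>
  if |x 0| ≤ 1 then 1 / (|x 0| * Real.log (Real.exp 1 / |x 0|) ^ 2) else 1

/-- The pair of weights `(w_1, w_2)` on `ℝ` with `w_1 = logWeight` and `w_2 = 1`. -/
def logPair : Fin 2 → (Fin 1 → ℝ) → ℝ := ![logWeight, fun _ => 1]

end Muckenhoupt

end

namespace Muckenhoupt

/-! ### Averages over cubes and Hölder's inequality. -/

section Averages

variable {n : ℕ}

/-! For (a), let `w_i` lie in `A_{q_i}`. Hölder applied to the product weight and the duals `w_i ^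
(1 - q_i')`, with exponents that cancel every `w_i`, bounds a product of averages below by 1.
Multiplying by the averages of the `w_i` turns the dual averages into `A_{q_i}` quotients
(`prod_cubeAvg_le`). Hence the product of the `p_i`-th roots of the `A_{p_i}` quotients is bounded
uniformly over cubes. Each factor is at least 1 (`one_le_cubeAvg_mul_cubeAvg`), so each is bounded.

For (b), write `w_1 = 1 / φ(|x|)` with `φ = logGauge`: `φ` is almost increasing and `φ(x) / x` is
decreasing. If `M` is the largest distance to the origin on an interval, then `w_1 ^ s` has average
at most a constant times `φ(M) ^ (-s)` for `s < 1`, and `w_1 ^ (-t)` at most a constant times `φ(M)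
^ t`. The multilinear condition sees only `s = p / p_1 < 1`, and the powers of `φ(M)` cancel. At `s
= 1` a logarithm is lost: on `[0, h]` every `A_q` quotient is at least a constant times `1 - log h`,
which is unbounded. -/

lemma measurableSet_cube (a : Fin n → ℝ) (h : ℝ) : MeasurableSet (cube a h) :=
  measurableSet_Icc

lemma volume_cube (a : Fin n → ℝ) (h : ℝ) : volume (cube a h) = ENNReal.ofReal h ^ n := by
  simp [cube, Real.volume_Icc_pi]

/-- The normalized Lebesgue measure on a cube. -/
noncomputable def cubeMeasure (a : Fin n → ℝ) (h : ℝ) : Measure (Fin n → ℝ) :=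
  (volume (cube a h))⁻¹ • volume.restrict (cube a h)

lemma cubeAvg_eq_lintegral (a : Fin n → ℝ) (h : ℝ) (f : (Fin n → ℝ) → ℝ) :
    cubeAvg a h f = ∫⁻ x, ENNReal.ofReal (f x) ∂(cubeMeasure a h) := by
  rw [cubeAvg, setLAverage_eq', cubeMeasure]

lemma isProbabilityMeasure_cubeMeasure (a : Fin n → ℝ) {h : ℝ} (hh : 0 < h) :
    IsProbabilityMeasure (cubeMeasure a h) := by
  constructor
  have h0 : volume (cube a h) ≠ 0 := by
    rw [volume_cube]; exact pow_ne_zero _ (by simpa using hh)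
  have h1 : volume (cube a h) ≠ ∞ := by
    rw [volume_cube]; exact ENNReal.pow_ne_top ENNReal.ofReal_ne_top
  simp [cubeMeasure, ENNReal.inv_mul_cancel h0 h1]

lemma cubeMeasure_absolutelyContinuous (a : Fin n → ℝ) (h : ℝ) :
    cubeMeasure a h ≪ volume :=
  Measure.AbsolutelyContinuous.trans Measure.smul_absolutelyContinuous
    Measure.restrict_le_self.absolutelyContinuous

/-- Hölder's inequality for finitely many functions whose weighted geometric mean is `1`. -/
lemma one_le_prod_lintegral_rpow {Ω ι : Type*} [MeasurableSpace Ω] [Fintype ι] {μ : Measure Ω}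
    [IsProbabilityMeasure μ] {f : ι → Ω → ℝ} (hf : ∀ i, AEMeasurable (f i) μ) {c : ι → ℝ}
    (hc : ∀ i, 0 ≤ c i) (hc1 : ∑ i, c i = 1) (hpos : ∀ᵐ x ∂μ, ∀ i, 0 < f i x)
    (hprod : ∀ᵐ x ∂μ, ∏ i, f i x ^ c i = 1) :
    1 ≤ ∏ i, (∫⁻ x, ENNReal.ofReal (f i x) ∂μ) ^ c i := by
  have key : ∫⁻ x, ∏ i, ENNReal.ofReal (f i x) ^ c i ∂μ = 1 := by
    have : ∀ᵐ x ∂μ, ∏ i, ENNReal.ofReal (f i x) ^ c i = 1 := by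
      filter_upwards [hpos, hprod] with x hx hx1
      rw [← ENNReal.ofReal_one, ← hx1, ENNReal.ofReal_prod_of_nonneg
        fun i _ => Real.rpow_nonneg (hx i).le _]
      exact Finset.prod_congr rfl fun i _ => ENNReal.ofReal_rpow_of_pos (hx i)
    rw [lintegral_congr_ae this]
    simp
  rw [← key]
  exact ENNReal.lintegral_prod_norm_pow_le _ (fun i _ => (hf i).ennreal_ofReal) hc1
    fun i _ => hc i

/-- Source of both Hölder bounds in (a). Averages take values in `ℝ≥0∞`, so no integrability is
needed. -/
lemma one_le_prod_cubeAvg_rpow {ι : Type*} [Fintype ι] {f : ι → (Fin n → ℝ) → ℝ}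
    (hf : ∀ i, IsWeight (f i)) {c : ι → ℝ} (hc : ∀ i, 0 ≤ c i) (hc1 : ∑ i, c i = 1)
    (hprod : ∀ᵐ x ∂(volume : Measure (Fin n → ℝ)), ∏ i, f i x ^ c i = 1)
    (a : Fin n → ℝ) {h : ℝ} (hh : 0 < h) : 1 ≤ ∏ i, cubeAvg a h (f i) ^ c i := by
  have := isProbabilityMeasure_cubeMeasure a hh
  have hac := cubeMeasure_absolutelyContinuous a h
  simp only [cubeAvg_eq_lintegral]
  exact one_le_prod_lintegral_rpow (fun i => (hf i).1.mono_ac hac) hc hc1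
    (hac.ae_le (ae_all_iff.2 fun i => (hf i).2)) (hac.ae_le hprod)

end Averages

/-! ### Part (a): `A_∞` components force a product weight. -/

section Weights

variable {n : ℕ}

lemma IsWeight.rpow {w : (Fin n → ℝ) → ℝ} (hw : IsWeight w) (r : ℝ) :
    IsWeight (fun x => w x ^ r) :=
  ⟨hw.1.pow_const r, hw.2.mono fun _ hx => Real.rpow_pos_of_pos hx r⟩

lemma IsWeight.prodWeight {m : ℕ} {w : Fin m → (Fin n → ℝ) → ℝ} (hw : ∀ i, IsWeight (w i))
    (p : Fin m → ℝ) : IsWeight (prodWeight p w) := by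
  refine ⟨Finset.aemeasurable_fun_prod _ fun i _ => (hw i).1.pow_const _, ?_⟩
  filter_upwards [ae_all_iff.2 fun i => (hw i).2] with x hx
  exact Finset.prod_pos fun i _ => Real.rpow_pos_of_pos (hx i) _

lemma one_sub_conjExponent {p : ℝ} (hp : 1 < p) : 1 - Real.conjExponent p = -(p - 1)⁻¹ := by
  have : p - 1 ≠ 0 := by linarith
  rw [Real.conjExponent]; field_simp; ring

lemma one_div_conjExponent (p : ℝ) : 1 / Real.conjExponent p = (p - 1) / p := by
  rw [Real.conjExponent, one_div_div]

lemma le_apConst (p : ℝ) (w : (Fin n → ℝ) → ℝ) (a : Fin n → ℝ) {h : ℝ} (hh : 0 < h) :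
    cubeAvg a h w * cubeAvg a h (fun x => w x ^ (1 - Real.conjExponent p)) ^ (p - 1) ≤
      apConst p w :=
  le_iSup_of_le a (le_iSup_of_le h (le_iSup_of_le hh le_rfl))

lemma le_multiApConst {m : ℕ} (p : Fin m → ℝ) (w : Fin m → (Fin n → ℝ) → ℝ) (a : Fin n → ℝ)
    {h : ℝ} (hh : 0 < h) :
    cubeAvg a h (prodWeight p w) ^ (1 / totalExponent p) *
      ∏ i, cubeAvg a h (fun x => w i x ^ (1 - Real.conjExponent (p i))) ^
        (1 / Real.conjExponent (p i)) ≤ multiApConst p w :=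
  le_iSup_of_le a (le_iSup_of_le h (le_iSup_of_le hh le_rfl))

/-- The `A_p` quotient over a cube is at least one. -/
lemma one_le_cubeAvg_mul_cubeAvg {p : ℝ} (hp : 1 < p) {w : (Fin n → ℝ) → ℝ} (hw : IsWeight w)
    (a : Fin n → ℝ) {h : ℝ} (hh : 0 < h) :
    1 ≤ cubeAvg a h w ^ (1 / p) *
      cubeAvg a h (fun x => w x ^ (1 - Real.conjExponent p)) ^ (1 / Real.conjExponent p) := by
  have hp0 : 0 < p := by linarith
  have hp1 : 0 < p - 1 := by linarith
  have key := one_le_prod_cubeAvg_rpow (ι := Fin 2)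
    (f := ![w, fun x => w x ^ (1 - Real.conjExponent p)])
    (c := ![1 / p, 1 / Real.conjExponent p]) (fun i => by fin_cases i <;> simp [hw, hw.rpow])
    (fun i => by
      fin_cases i
      · simp [hp0.le]
      · simp only [one_div_conjExponent p]; simp; positivity)
    (by simp [one_div_conjExponent p]; field_simp; ring)
    (by
      filter_upwards [hw.2] with x hx
      simp only [Fin.prod_univ_two, Matrix.cons_val_zero, Matrix.cons_val_one]
      rw [← Real.rpow_mul hx.le, ← Real.rpow_add hx, one_div_conjExponent p,
        one_sub_conjExponent hp]
      convert Real.rpow_zero (w x) using 2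
      field_simp; ring) a hh
  simpa [Fin.prod_univ_two] using key

lemma totalExponent_pos {m : ℕ} {p : Fin m → ℝ} (hp : ∀ i, 1 < p i) (i : Fin m) :
    0 < totalExponent p := by
  have h0 : ∀ j, 0 < 1 / p j := fun j => by have := hp j; positivity
  exact inv_pos.2 (Finset.sum_pos (fun j _ => h0 j) ⟨i, Finset.mem_univ i⟩)

/-- For `A_q` weights the geometric mean of the averages is controlled by the average of the
product weight. -/
lemma prod_cubeAvg_le {m : ℕ} {p q : Fin m → ℝ} (hp : ∀ i, 1 < p i) (hq : ∀ i, 1 < q i)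
    {w : Fin m → (Fin n → ℝ) → ℝ} (hw : ∀ i, IsWeight (w i)) (i₀ : Fin m)
    (a : Fin n → ℝ) {h : ℝ} (hh : 0 < h) :
    ∏ i, cubeAvg a h (w i) ^ (1 / p i) ≤
      cubeAvg a h (prodWeight p w) ^ (1 / totalExponent p) *
        ∏ i, apConst (q i) (w i) ^ (1 / p i) := by
  have hP := totalExponent_pos hp i₀
  set P := totalExponent p
  have hp0 : ∀ i, 0 < p i := fun i => by linarith [hp i]
  have hq0 : ∀ i, 0 < q i - 1 := fun i => by linarith [hq i]
  set σ : Fin m → (Fin n → ℝ) → ℝ := fun i x => w i x ^ (1 - Real.conjExponent (q i))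
  have hD : 0 < 1 + ∑ i, P * (q i - 1) / p i := by
    have : 0 ≤ ∑ i, P * (q i - 1) / p i := Finset.sum_nonneg fun i _ => by
      have := hp0 i; have := hq0 i; positivity
    linarith
  -- Normalizes the Hölder exponents to sum 1. Their ratios are forced: the power of `w i` is `θ * P
  -- / p i` from the product weight and its negative from `σ i`.
  set θ := (1 + ∑ i, P * (q i - 1) / p i)⁻¹ with hθ
  have hθ0 : 0 < θ := inv_pos.2 hD
  have key := one_le_prod_cubeAvg_rpow (ι := Option (Fin m))
    (f := fun o => o.elim (prodWeight p w) σ)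
    (c := fun o => o.elim θ fun i => θ * (P * (q i - 1) / p i))
    (fun o => by
      cases o with
      | none => exact IsWeight.prodWeight hw p
      | some i => exact (hw i).rpow _)
    (fun o => by
      cases o with
      | none => exact hθ0.le
      | some i => have := hp0 i; have := hq0 i; simp only [Option.elim]; positivity)
    (by
      simp only [Fintype.sum_option, Option.elim]
      rw [← Finset.mul_sum, hθ]; field_simp)
    (by
      filter_upwards [ae_all_iff.2 fun i => (hw i).2] with x hx
      simp only [Fintype.prod_option, Option.elim, prodWeight, σ]
      rw [← Real.finsetProd_rpow _ _ fun i _ => Real.rpow_nonneg (hx i).le _,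
        ← Finset.prod_mul_distrib]
      refine Finset.prod_eq_one fun i _ => ?_
      rw [← Real.rpow_mul (hx i).le, ← Real.rpow_mul (hx i).le, ← Real.rpow_add (hx i),
        one_sub_conjExponent (hq i)]
      convert Real.rpow_zero (w i x) using 2
      have := (hp0 i).ne'; have := (hq0 i).ne'
      change P / p i * θ + _ = 0
      field_simp; ring) a hh
  simp only [Fintype.prod_option, Option.elim] at key
  have h1 : 1 ≤ cubeAvg a h (prodWeight p w) ^ (1 / P) *
      ∏ i, cubeAvg a h (σ i) ^ ((q i - 1) / p i) := by
    -- Raising to the power `1 / (θ * P)` removes the normalization.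
    have hr : 0 ≤ 1 / (θ * P) := by positivity
    have := ENNReal.rpow_le_rpow key hr
    rw [ENNReal.one_rpow, ENNReal.mul_rpow_of_nonneg _ _ hr, ← ENNReal.rpow_mul,
      ← ENNReal.prod_rpow_of_nonneg hr] at this
    convert this using 2
    · congr 1; field_simp
    · refine Finset.prod_congr rfl fun i _ => ?_
      rw [← ENNReal.rpow_mul]
      congr 1
      have := (hp0 i).ne'
      field_simp
  calc ∏ i, cubeAvg a h (w i) ^ (1 / p i)
      ≤ (cubeAvg a h (prodWeight p w) ^ (1 / P) *
          ∏ i, cubeAvg a h (σ i) ^ ((q i - 1) / p i)) * ∏ i, cubeAvg a h (w i) ^ (1 / p i) :=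
        le_mul_of_one_le_left zero_le h1
    _ = cubeAvg a h (prodWeight p w) ^ (1 / P) *
          ∏ i, (cubeAvg a h (w i) * cubeAvg a h (σ i) ^ (q i - 1)) ^ (1 / p i) := by
        rw [mul_assoc, ← Finset.prod_mul_distrib]
        congr 1
        refine Finset.prod_congr rfl fun i _ => ?_
        have := hp0 i
        rw [ENNReal.mul_rpow_of_nonneg _ _ (by positivity), ← ENNReal.rpow_mul, mul_comm,
          mul_one_div]
    _ ≤ _ := by
        gcongr with i _
        · have := hp0 i; positivity
        · exact le_apConst (q i) (w i) a hh

/-- A vector of `A_∞` weights in `A_{(p_1, …, p_m)}` is a product weight. -/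
theorem IsMultiAp.isProductAp {m : ℕ} {p : Fin m → ℝ} (hp : ∀ i, 1 < p i)
    {w : Fin m → (Fin n → ℝ) → ℝ} (hw : IsMultiAp p w) (hw' : ∀ i, IsAinfty (w i)) :
    IsProductAp p w := by
  intro i
  choose q hq hAq using hw'
  refine ⟨hw.1 i, ?_⟩
  have hp0 : ∀ i, 0 < p i := fun i => by linarith [hp i]
  set K := multiApConst p w * ∏ j, apConst (q j) (w j) ^ (1 / p j)
  have hK : K < ∞ := ENNReal.mul_lt_top hw.2 <| ENNReal.prod_lt_top fun j _ =>
    ENNReal.rpow_lt_top_of_nonneg (one_div_nonneg.2 (hp0 j).le) (hAq j).2.ne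
  refine lt_of_le_of_lt (b := K ^ p i) ?_ (ENNReal.rpow_lt_top_of_nonneg (hp0 i).le hK.ne)
  refine iSup_le fun a => iSup_le fun h => iSup_le fun hh => ?_
  set F : Fin m → ℝ≥0∞ := fun j => cubeAvg a h (w j) ^ (1 / p j) *
    cubeAvg a h (fun x => w j x ^ (1 - Real.conjExponent (p j))) ^ (1 / Real.conjExponent (p j))
  -- All factors are at least 1, so a single one is bounded by the product.
  have hF : F i ≤ K := by
    calc F i ≤ ∏ j, F j := Finset.single_le_prod'
          (fun j _ => one_le_cubeAvg_mul_cubeAvg (hp j) (hw.1 j) a hh) (Finset.mem_univ i)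
      _ ≤ K := by
          simp only [F, K]
          rw [Finset.prod_mul_distrib]
          refine (mul_le_mul_left (prod_cubeAvg_le hp hq hw.1 i a hh) _).trans ?_
          rw [mul_right_comm]
          exact mul_le_mul_left (le_multiApConst p w a hh) _
  refine le_trans (le_of_eq ?_) (ENNReal.rpow_le_rpow hF (hp0 i).le)
  have := (hp0 i).ne'
  simp only [F]
  rw [ENNReal.mul_rpow_of_nonneg _ _ (hp0 i).le, ← ENNReal.rpow_mul, ← ENNReal.rpow_mul,
    one_div_mul_cancel this, ENNReal.rpow_one, one_div_conjExponent (p i), div_mul_cancel₀ _ this]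

end Weights

/-! ### The gauge `φ` and its monotonicity properties. -/

section Gauge

/-- The reciprocal of the logarithmic weight, as a function of the distance to the origin. -/
noncomputable def logGauge (x : ℝ) : ℝ := if x ≤ 1 then x * (1 - Real.log x) ^ 2 else 1

lemma one_le_one_sub_log {x : ℝ} (hx : 0 < x) (hx1 : x ≤ 1) : 1 ≤ 1 - Real.log x := by
  linarith [Real.log_nonpos hx.le hx1]

lemma logGauge_of_le_one {x : ℝ} (hx : x ≤ 1) : logGauge x = x * (1 - Real.log x) ^ 2 :=
  if_pos hx

lemma logGauge_of_one_lt {x : ℝ} (hx : 1 < x) : logGauge x = 1 := if_neg hx.not_ge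

lemma logGauge_pos {x : ℝ} (hx : 0 < x) : 0 < logGauge x := by
  rcases le_or_gt x 1 with h | h
  · have := one_le_one_sub_log hx h
    rw [logGauge_of_le_one h]; positivity
  · simp [logGauge_of_one_lt h]

lemma logGauge_le_four {x : ℝ} (hx : 0 < x) : logGauge x ≤ 4 := by
  rcases le_or_gt x 1 with h | h
  · rw [logGauge_of_le_one h]
    have hs : 0 < √x := Real.sqrt_pos.2 hx
    have h1 : Real.log (√x)⁻¹ ≤ (√x)⁻¹ - 1 := Real.log_le_sub_one_of_pos (inv_pos.2 hs)
    rw [Real.log_inv, Real.log_sqrt hx.le] at h1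
    have h2 : √x * (1 - Real.log x) ≤ 2 := by
      calc √x * (1 - Real.log x) ≤ √x * (2 * (√x)⁻¹) := by gcongr; linarith
        _ = 2 := by field_simp
    have h3 : 0 ≤ √x * (1 - Real.log x) :=
      mul_nonneg hs.le (by linarith [one_le_one_sub_log hx h])
    calc x * (1 - Real.log x) ^ 2 = (√x * (1 - Real.log x)) ^ 2 := by
          rw [mul_pow, Real.sq_sqrt hx.le]
      _ ≤ 2 ^ 2 := by gcongr
      _ = 4 := by norm_num
  · simp [logGauge_of_one_lt h]

/-- The gauge is increasing up to a constant factor. -/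
lemma logGauge_le_four_mul {x M : ℝ} (hx : 0 < x) (hxM : x ≤ M) :
    logGauge x ≤ 4 * logGauge M := by
  have hM : 0 < M := hx.trans_le hxM
  rcases le_or_gt M 1 with h | h
  · have hr : x / M ≤ 1 := (div_le_one hM).2 hxM
    have hr0 : 0 < x / M := div_pos hx hM
    have h1 := one_le_one_sub_log hr0 hr
    have h2 := one_le_one_sub_log hM h
    have hlog : Real.log x = Real.log (x / M) + Real.log M := by
      rw [Real.log_div hx.ne' hM.ne']; ring
    -- This is `1 + u + v ≤ (1 + u) * (1 + v)` for `u, v ≥ 0`; it makes the gauge submultiplicative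
    -- on `(0, 1]`.
    have h3 : 1 - Real.log x ≤ (1 - Real.log (x / M)) * (1 - Real.log M) := by
      rw [hlog]; nlinarith
    have h0 := one_le_one_sub_log hx (hxM.trans h)
    calc logGauge x = x * (1 - Real.log x) ^ 2 := logGauge_of_le_one (hxM.trans h)
      _ ≤ x * ((1 - Real.log (x / M)) * (1 - Real.log M)) ^ 2 := by gcongr
      _ = logGauge (x / M) * logGauge M := by
          rw [logGauge_of_le_one hr, logGauge_of_le_one h]; field_simp
      _ ≤ 4 * logGauge M :=
          mul_le_mul_of_nonneg_right (logGauge_le_four hr0) (logGauge_pos hM).le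
  · rw [logGauge_of_one_lt h, mul_one]
    exact logGauge_le_four hx

/-- The gauge divided by the identity is decreasing. -/
lemma div_mul_logGauge_le {x M : ℝ} (hx : 0 < x) (hxM : x ≤ M) :
    x / M * logGauge M ≤ logGauge x := by
  have hM : 0 < M := hx.trans_le hxM
  have hr : x / M ≤ 1 := (div_le_one hM).2 hxM
  rcases le_or_gt M 1 with h | h
  · have h2 := one_le_one_sub_log hM h
    rw [logGauge_of_le_one h, logGauge_of_le_one (hxM.trans h), ← mul_assoc,
      div_mul_cancel₀ _ hM.ne']
    have := Real.log_le_log hx hxM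
    gcongr
  · rw [logGauge_of_one_lt h, mul_one]
    rcases le_or_gt x 1 with h' | h'
    · rw [logGauge_of_le_one h']
      have := one_le_one_sub_log hx h'
      calc x / M ≤ x := div_le_self hx.le h.le
        _ ≤ x * (1 - Real.log x) ^ 2 := le_mul_of_one_le_right hx.le (one_le_pow₀ this)
    · rwa [logGauge_of_one_lt h']

lemma measurable_logGauge : Measurable logGauge :=
  Measurable.ite measurableSet_Iic
    (measurable_id.mul ((measurable_const.sub Real.measurable_log).pow_const 2)) measurable_const

lemma logWeight_eq (y : Fin 1 → ℝ) : logWeight y = (logGauge |y 0|)⁻¹ := by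
  unfold logWeight logGauge
  split_ifs with h
  · rcases eq_or_ne (y 0) 0 with h0 | h0
    -- At the origin both sides are 0, by the convention for division by zero.
    · simp [h0]
    · rw [Real.log_div (Real.exp_ne_zero _) (abs_ne_zero.2 h0), Real.log_exp, one_div]
  · simp

/-- The logarithmic weight is the derivative of `x ↦ 1 / (1 - log x)`. -/
lemma integrableOn_integral_inv_logGauge {h : ℝ} (hh : 0 < h) (h1 : h ≤ 1) :
    IntegrableOn (fun x => (logGauge x)⁻¹) (Set.Ioc 0 h) ∧
      ∫ x in Set.Ioc 0 h, (logGauge x)⁻¹ = (1 - Real.log h)⁻¹ := by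
  -- The value at 0 must be set to the limit 0: since `Real.log 0 = 0`, the bare formula would give
  -- 1 there and break continuity.
  set G : ℝ → ℝ := fun x => if x ≤ 0 then 0 else (1 - Real.log x)⁻¹ with hG
  have hGpos : ∀ x, 0 < x → G =ᶠ[nhds x] fun x => (1 - Real.log x)⁻¹ := fun x hx => by
    filter_upwards [lt_mem_nhds hx] with y hy
    exact if_neg hy.not_ge
  have hderiv : ∀ x ∈ Set.Ioc 0 h, HasDerivAt G (logGauge x)⁻¹ x := fun x hx => by
    have h2 := one_le_one_sub_log hx.1 (hx.2.trans h1)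
    have h3 : 1 - Real.log x ≠ 0 := by linarith
    refine HasDerivAt.congr_of_eventuallyEq ?_ (hGpos x hx.1)
    have h4 : (logGauge x)⁻¹ = -(-x⁻¹) / (1 - Real.log x) ^ 2 := by
      have := hx.1.ne'
      rw [logGauge_of_le_one (hx.2.trans h1)]
      field_simp
    rw [h4]
    exact ((Real.hasDerivAt_log hx.1.ne').const_sub 1).fun_inv h3
  have hcont : ContinuousOn G (Set.Icc 0 h) := fun x hx => by
    rcases hx.1.eq_or_lt with h0 | h0
    · subst h0
      refine ContinuousWithinAt.mono ?_ Set.Icc_subset_Ici_self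
      rw [← continuousWithinAt_Ioi_iff_Ici]
      have h2 : Filter.Tendsto (fun x => (1 - Real.log x)⁻¹) (nhdsWithin 0 (Set.Ioi 0)) (nhds 0) :=
        tendsto_inv_atTop_zero.comp
          (Filter.tendsto_atTop_add_const_left _ 1
            (Filter.tendsto_neg_atBot_atTop.comp Real.tendsto_log_nhdsGT_zero))
      have h3 : G 0 = 0 := if_pos le_rfl
      rw [ContinuousWithinAt, h3]
      refine h2.congr' ?_
      filter_upwards [self_mem_nhdsWithin] with y hy
      exact (if_neg (not_le.2 hy)).symm
    · exact (hderiv x ⟨h0, hx.2⟩).continuousAt.continuousWithinAt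
  have hint : IntegrableOn (fun x => (logGauge x)⁻¹) (Set.Ioc 0 h) :=
    intervalIntegral.integrableOn_deriv_of_nonneg hcont
      (fun x hx => hderiv x (Set.Ioo_subset_Ioc_self hx))
      fun x hx => (inv_pos.2 (logGauge_pos hx.1)).le
  refine ⟨hint, ?_⟩
  rw [← intervalIntegral.integral_of_le hh.le,
    intervalIntegral.integral_eq_sub_of_hasDerivAt_of_le hh.le hcont
      (fun x hx => hderiv x (Set.Ioo_subset_Ioc_self hx))
      ((intervalIntegrable_iff_integrableOn_Ioc_of_le hh.le).2 hint)]
  simp [hG, hh.not_ge]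

end Gauge

/-! ### Averages over intervals and power weights. -/

section OneDimensional

lemma measurePreserving_eval_zero :
    MeasurePreserving (fun y : Fin 1 → ℝ => y 0) volume volume :=
  volume_preserving_funUnique (Fin 1) ℝ

lemma ae_apply_zero_ne : ∀ᵐ y : Fin 1 → ℝ, y 0 ≠ 0 :=
  measurePreserving_eval_zero.quasiMeasurePreserving.ae (Measure.ae_ne volume 0)

lemma cubeAvg_eq_div (a : Fin 1 → ℝ) (h : ℝ) (g : ℝ → ℝ) :
    cubeAvg a h (fun y => g (y 0)) =
      (∫⁻ x in Set.Icc (a 0) (a 0 + h), ENNReal.ofReal (g x)) / ENNReal.ofReal h := by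
  have hpre : cube a h = (fun y : Fin 1 → ℝ => y 0) ⁻¹' Set.Icc (a 0) (a 0 + h) := by
    ext y
    simp [cube, Pi.le_def]
  rw [cubeAvg, setLAverage_eq, volume_cube, pow_one, hpre]
  congr 1
  exact measurePreserving_eval_zero.setLIntegral_comp_preimage_emb
    (MeasurableEquiv.funUnique (Fin 1) ℝ).measurableEmbedding
    (fun x => ENNReal.ofReal (g x)) _

lemma cubeAvg_mono_ae {n : ℕ} {a : Fin n → ℝ} {h : ℝ} {f g : (Fin n → ℝ) → ℝ}
    (hfg : ∀ᵐ y, y ∈ cube a h → f y ≤ g y) : cubeAvg a h f ≤ cubeAvg a h g := by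
  rw [cubeAvg, cubeAvg, setLAverage_eq, setLAverage_eq]
  refine ENNReal.div_le_div_right (lintegral_mono_ae ?_) _
  rw [ae_restrict_iff' (measurableSet_cube a h)]
  exact hfg.mono fun y hy hya => ENNReal.ofReal_le_ofReal (hy hya)

lemma cubeAvg_const {n : ℕ} (a : Fin n → ℝ) {h : ℝ} (hh : 0 < h) (c : ℝ) :
    cubeAvg a h (fun _ => c) = ENNReal.ofReal c := by
  have := isProbabilityMeasure_cubeMeasure a hh
  simp [cubeAvg_eq_lintegral]

lemma cubeAvg_const_mul {n : ℕ} (a : Fin n → ℝ) (h : ℝ) {c : ℝ} (hc : 0 ≤ c)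
    (f : (Fin n → ℝ) → ℝ) :
    cubeAvg a h (fun y => c * f y) = ENNReal.ofReal c * cubeAvg a h f := by
  simp only [cubeAvg_eq_lintegral, ENNReal.ofReal_mul hc]
  exact lintegral_const_mul' _ _ ENNReal.ofReal_ne_top

lemma setLIntegral_comp_abs_le (f : ℝ → ℝ≥0∞) (M : ℝ) :
    ∫⁻ x in Set.Icc (-M) M, f |x| ≤ 2 * ∫⁻ x in Set.Ioc 0 M, f x := by
  have hsub : Set.Icc (-M) M ⊆ (Set.Ico (-M) 0 ∪ Set.Ioc 0 M) ∪ {0} := fun x hx => by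
    rcases lt_trichotomy x 0 with h | h | h
    · exact Or.inl (Or.inl ⟨hx.1, h⟩)
    · exact Or.inr h
    · exact Or.inl (Or.inr ⟨h, hx.2⟩)
  have hpos : ∫⁻ x in Set.Ioc 0 M, f |x| = ∫⁻ x in Set.Ioc 0 M, f x :=
    setLIntegral_congr_fun measurableSet_Ioc fun x hx => by simp only [abs_of_pos hx.1]
  have hneg : ∫⁻ x in Set.Ico (-M) 0, f |x| = ∫⁻ x in Set.Ioc 0 M, f x := by
    rw [← hpos, ← (Measure.measurePreserving_neg (volume : Measure ℝ)).setLIntegral_comp_preimage_emb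
      (MeasurableEquiv.neg ℝ).measurableEmbedding]
    simp
  calc ∫⁻ x in Set.Icc (-M) M, f |x|
      ≤ ∫⁻ x in (Set.Ico (-M) 0 ∪ Set.Ioc 0 M) ∪ {0}, f |x| := lintegral_mono_set hsub
    _ ≤ (∫⁻ x in Set.Ico (-M) 0, f |x|) + (∫⁻ x in Set.Ioc 0 M, f |x|) +
          ∫⁻ x in {0}, f |x| :=
        (lintegral_union_le _ _ _).trans (add_le_add_left (lintegral_union_le _ _ _) _)
    _ = 2 * ∫⁻ x in Set.Ioc 0 M, f x := by rw [hneg, hpos]; simp [two_mul]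

lemma setLIntegral_rpow_neg {s M : ℝ} (hs : s < 1) (hM : 0 < M) :
    ∫⁻ x in Set.Ioc 0 M, ENNReal.ofReal (x ^ (-s)) = ENNReal.ofReal (M ^ (1 - s) / (1 - s)) := by
  have hs' : -1 < -s := by linarith
  rw [← ofReal_integral_eq_lintegral_ofReal
    ((intervalIntegrable_iff_integrableOn_Ioc_of_le hM.le).1
      (intervalIntegral.intervalIntegrable_rpow' hs'))
    ((ae_restrict_iff' measurableSet_Ioc).2 (ae_of_all _ fun x hx => Real.rpow_nonneg hx.1.le _)),
    ← intervalIntegral.integral_of_le hM.le, integral_rpow (Or.inl hs'), neg_add_eq_sub,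
    Real.zero_rpow (by linarith), sub_zero]

lemma abs_le_max_of_mem_cube {a y : Fin 1 → ℝ} {h : ℝ} (hy : y ∈ cube a h) :
    |y 0| ≤ max |a 0| |a 0 + h| :=
  abs_le_max_abs_abs (hy.1 0) (hy.2 0)

lemma half_le_max_abs (b h : ℝ) : h / 2 ≤ max |b| |b + h| := by
  rcases le_total (-b) (h / 2) with h1 | h1
  · exact le_max_of_le_right ((by linarith : h / 2 ≤ b + h).trans (le_abs_self _))
  · exact le_max_of_le_left (h1.trans (neg_le_abs b))

/-- The power weight `|x| ^ (-s)`, `0 ≤ s < 1`, satisfies an `A_1` estimate. -/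
lemma cubeAvg_abs_rpow_neg_le {s : ℝ} (hs0 : 0 ≤ s) (hs : s < 1) (a : Fin 1 → ℝ) {h : ℝ}
    (hh : 0 < h) :
    cubeAvg a h (fun y => |y 0| ^ (-s)) ≤
      ENNReal.ofReal (4 / (1 - s) * max |a 0| |a 0 + h| ^ (-s)) := by
  have hhalf := half_le_max_abs (a 0) h
  set M := max |a 0| |a 0 + h| with hMdef
  have hM : 0 < M := by linarith
  have hs1 : 0 < 1 - s := by linarith
  have hMs : 0 < M ^ (-s) := Real.rpow_pos_of_pos hM _
  -- Far from the origin, `|y 0|` is comparable to `M` on the whole interval. Otherwise `M < 2 * h`,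
  -- and enlarging to `[-M, M]` costs only a constant.
  rcases le_or_gt (2 * h) M with hc | hc
  · rw [← cubeAvg_const a hh]
    refine cubeAvg_mono_ae (ae_of_all _ fun y hy => ?_)
    have h1 : M / 2 ≤ |y 0| := by
      have e1 := hy.1 0
      have e2 : y 0 ≤ a 0 + h := hy.2 0
      have e3 : M ≤ |y 0| + h := by
        refine max_le ?_ ?_
        · have := abs_sub_abs_le_abs_sub (a 0) (y 0)
          have : |a 0 - y 0| ≤ h := abs_le.2 ⟨by linarith, by linarith⟩
          linarith
        · have := abs_sub_abs_le_abs_sub (a 0 + h) (y 0)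
          have : |a 0 + h - y 0| ≤ h := abs_le.2 ⟨by linarith, by linarith⟩
          linarith
      linarith
    calc |y 0| ^ (-s) ≤ (M / 2) ^ (-s) :=
          Real.rpow_le_rpow_of_nonpos (by positivity) h1 (by linarith)
      _ = 2 ^ s * M ^ (-s) := by
          rw [Real.div_rpow hM.le two_pos.le, Real.rpow_neg two_pos.le, div_inv_eq_mul, mul_comm]
      _ ≤ 4 / (1 - s) * M ^ (-s) := by
          gcongr
          calc (2 : ℝ) ^ s ≤ 2 ^ (1 : ℝ) := Real.rpow_le_rpow_of_exponent_le one_le_two hs.le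
            _ ≤ 4 / (1 - s) := by rw [Real.rpow_one, le_div_iff₀ hs1]; linarith
  · rw [cubeAvg_eq_div a h fun x => |x| ^ (-s)]
    refine ENNReal.div_le_of_le_mul ?_
    have hsub : Set.Icc (a 0) (a 0 + h) ⊆ Set.Icc (-M) M := fun x hx =>
      abs_le.1 (abs_le_max_abs_abs hx.1 hx.2)
    calc ∫⁻ x in Set.Icc (a 0) (a 0 + h), ENNReal.ofReal (|x| ^ (-s))
        ≤ ∫⁻ x in Set.Icc (-M) M, ENNReal.ofReal (|x| ^ (-s)) := lintegral_mono_set hsub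
      _ ≤ 2 * ∫⁻ x in Set.Ioc 0 M, ENNReal.ofReal (x ^ (-s)) :=
          setLIntegral_comp_abs_le (fun x => ENNReal.ofReal (x ^ (-s))) M
      _ = ENNReal.ofReal (2 * (M ^ (1 - s) / (1 - s))) := by
          rw [setLIntegral_rpow_neg hs hM, ENNReal.ofReal_mul two_pos.le]; simp
      _ ≤ ENNReal.ofReal (4 / (1 - s) * M ^ (-s)) * ENNReal.ofReal h := by
          rw [← ENNReal.ofReal_mul (by positivity)]
          refine ENNReal.ofReal_le_ofReal ?_
          rw [sub_eq_add_neg 1 s, Real.rpow_add hM, Real.rpow_one, ← sub_eq_add_neg]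
          calc 2 * (M * M ^ (-s) / (1 - s)) ≤ 2 * ((2 * h) * M ^ (-s) / (1 - s)) := by gcongr
            _ = 4 / (1 - s) * M ^ (-s) * h := by ring

end OneDimensional

/-! ### Part (b): the logarithmic weight. -/

section LogWeight

lemma isWeight_logWeight : IsWeight logWeight := by
  have h : logWeight = fun y => (logGauge |y 0|)⁻¹ := funext logWeight_eq
  refine ⟨?_, ?_⟩
  · rw [h]
    exact (measurable_logGauge.comp (measurable_pi_apply 0).abs).inv.aemeasurable
  · filter_upwards [ae_apply_zero_ne] with y hy
    rw [logWeight_eq]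
    exact inv_pos.2 (logGauge_pos (abs_pos.2 hy))

lemma isWeight_logPair (i : Fin 2) : IsWeight (logPair i) := by
  fin_cases i
  · exact isWeight_logWeight
  · exact ⟨aemeasurable_const, ae_of_all _ fun _ => one_pos⟩

/-- Since `φ(x) / x` decreases, `w_1 ^ s` is dominated on the interval by `(φ(M) / M) ^ (-s) * |y| ^
(-s)`, which reduces the bound to the power weight. -/
lemma cubeAvg_logWeight_rpow_le {s : ℝ} (hs0 : 0 ≤ s) (hs : s < 1) (a : Fin 1 → ℝ) {h : ℝ}
    (hh : 0 < h) :
    cubeAvg a h (fun y => logWeight y ^ s) ≤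
      ENNReal.ofReal (4 / (1 - s) * logGauge (max |a 0| |a 0 + h|) ^ (-s)) := by
  have hhalf := half_le_max_abs (a 0) h
  have hA := cubeAvg_abs_rpow_neg_le hs0 hs a hh
  have hmem := fun y => abs_le_max_of_mem_cube (a := a) (y := y) (h := h)
  set M := max |a 0| |a 0 + h|
  have hM : 0 < M := by linarith
  have hφ := logGauge_pos hM
  have hc : 0 ≤ (logGauge M / M) ^ (-s) := by positivity
  calc cubeAvg a h (fun y => logWeight y ^ s)
      ≤ cubeAvg a h (fun y => (logGauge M / M) ^ (-s) * |y 0| ^ (-s)) := by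
        refine cubeAvg_mono_ae ?_
        filter_upwards [ae_apply_zero_ne] with y hy hya
        have hy0 := abs_pos.2 hy
        rw [logWeight_eq, Real.inv_rpow (logGauge_pos hy0).le,
          ← Real.rpow_neg (logGauge_pos hy0).le, ← Real.mul_rpow (by positivity) hy0.le]
        refine Real.rpow_le_rpow_of_nonpos (by positivity) ?_ (by linarith)
        calc logGauge M / M * |y 0| = |y 0| / M * logGauge M := by ring
          _ ≤ _ := div_mul_logGauge_le hy0 (hmem y hya)
    _ = ENNReal.ofReal ((logGauge M / M) ^ (-s)) * cubeAvg a h (fun y => |y 0| ^ (-s)) :=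
        cubeAvg_const_mul a h hc _
    _ ≤ ENNReal.ofReal ((logGauge M / M) ^ (-s)) *
          ENNReal.ofReal (4 / (1 - s) * M ^ (-s)) := by gcongr
    _ = ENNReal.ofReal (4 / (1 - s) * logGauge M ^ (-s)) := by
        rw [← ENNReal.ofReal_mul hc, Real.div_rpow hφ.le hM.le]
        have := (Real.rpow_pos_of_pos hM (-s)).ne'
        congr 1
        field_simp

lemma cubeAvg_logWeight_rpow_neg_le {t : ℝ} (ht : 0 ≤ t) (a : Fin 1 → ℝ) {h : ℝ}
    (hh : 0 < h) :
    cubeAvg a h (fun y => logWeight y ^ (-t)) ≤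
      ENNReal.ofReal ((4 * logGauge (max |a 0| |a 0 + h|)) ^ t) := by
  rw [← cubeAvg_const a hh]
  refine cubeAvg_mono_ae ?_
  filter_upwards [ae_apply_zero_ne] with y hy hya
  have hy0 := abs_pos.2 hy
  rw [logWeight_eq, Real.inv_rpow (logGauge_pos hy0).le, ← Real.rpow_neg (logGauge_pos hy0).le,
    neg_neg]
  exact Real.rpow_le_rpow (logGauge_pos hy0).le
    (logGauge_le_four_mul hy0 (abs_le_max_of_mem_cube hya)) ht

theorem isMultiAp_logPair {p : Fin 2 → ℝ} (hp : ∀ i, 1 < p i) : IsMultiAp p logPair := by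
  refine ⟨isWeight_logPair, ?_⟩
  have hP := totalExponent_pos hp 0
  set P := totalExponent p with hPdef
  have h0 : 0 < p 0 := by linarith [hp 0]
  have h1 : 0 < p 1 := by linarith [hp 1]
  have h01 : 0 < p 0 - 1 := by linarith [hp 0]
  set s := P / p 0 with hs
  have hs0 : 0 ≤ s := by positivity
  -- The second exponent enters here: `1 / P` exceeds `1 / p 0` by `1 / p 1 > 0`.
  have hs1 : s < 1 := by
    rw [hs, div_lt_one h0, hPdef, totalExponent, Fin.sum_univ_two]
    refine inv_lt_of_inv_lt₀ h0 ?_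
    rw [← one_div]
    linarith [one_div_pos.2 h1]
  have hs1' : 0 < 1 - s := by linarith
  set C := (4 / (1 - s)) ^ (1 / P) * 4 ^ (1 / p 0)
  refine lt_of_le_of_lt (b := ENNReal.ofReal C) ?_ ENNReal.ofReal_lt_top
  refine iSup_le fun a => iSup_le fun h => iSup_le fun hh => ?_
  have hhalf := half_le_max_abs (a 0) h
  have hA := cubeAvg_logWeight_rpow_le hs0 hs1 a hh
  have hB := cubeAvg_logWeight_rpow_neg_le (inv_pos.2 h01).le a hh
  set M := max |a 0| |a 0 + h|
  have hφ := logGauge_pos (show 0 < M by linarith)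
  have hW : prodWeight p logPair = fun y => logWeight y ^ s := by
    funext y
    simp [prodWeight, Fin.prod_univ_two, logPair, hs, hPdef]
  have hσ : ∀ r : ℝ, cubeAvg a h (fun y => logPair 1 y ^ r) = 1 := fun r => by
    simp only [logPair, Matrix.cons_val_one, Matrix.cons_val_fin_one, Real.one_rpow,
      cubeAvg_const a hh, ENNReal.ofReal_one]
  rw [hW, Fin.prod_univ_two, hσ, ENNReal.one_rpow, mul_one, one_sub_conjExponent (hp 0),
    one_div_conjExponent]
  calc cubeAvg a h (fun y => logWeight y ^ s) ^ (1 / P) *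
        cubeAvg a h (fun y => logWeight y ^ (-(p 0 - 1)⁻¹)) ^ ((p 0 - 1) / p 0)
      ≤ ENNReal.ofReal (4 / (1 - s) * logGauge M ^ (-s)) ^ (1 / P) *
          ENNReal.ofReal ((4 * logGauge M) ^ (p 0 - 1)⁻¹) ^ ((p 0 - 1) / p 0) := by gcongr
    _ = ENNReal.ofReal C := by
        rw [ENNReal.ofReal_rpow_of_nonneg (by positivity) (by positivity),
          ENNReal.ofReal_rpow_of_nonneg (by positivity) (by positivity),
          ← ENNReal.ofReal_mul (by positivity), Real.mul_rpow (by positivity) (by positivity),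
          ← Real.rpow_mul hφ.le, ← Real.rpow_mul (by positivity)]
        have e1 : -s * (1 / P) = -(1 / p 0) := by rw [hs]; field_simp
        have e2 : (p 0 - 1)⁻¹ * ((p 0 - 1) / p 0) = 1 / p 0 := by field_simp
        have := (Real.rpow_pos_of_pos hφ (1 / p 0)).ne'
        rw [e1, e2, Real.mul_rpow (by norm_num) hφ.le, Real.rpow_neg hφ.le]
        congr 1
        simp only [C]
        field_simp

lemma cubeAvg_zero_logWeight {h : ℝ} (hh : 0 < h) (h1 : h ≤ 1) :
    cubeAvg 0 h logWeight = ENNReal.ofReal ((1 - Real.log h)⁻¹ / h) := by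
  obtain ⟨hint, hval⟩ := integrableOn_integral_inv_logGauge hh h1
  have e : logWeight = fun y => (logGauge |y 0|)⁻¹ := funext logWeight_eq
  rw [e, cubeAvg_eq_div 0 h fun x => (logGauge |x|)⁻¹, ENNReal.ofReal_div_of_pos hh, ← hval,
    ofReal_integral_eq_lintegral_ofReal hint
      ((ae_restrict_iff' measurableSet_Ioc).2
        (ae_of_all _ fun x hx => (inv_pos.2 (logGauge_pos hx.1)).le))]
  simp only [Pi.zero_apply, zero_add]
  rw [setLIntegral_congr Ioc_ae_eq_Icc.symm]
  congr 1
  exact setLIntegral_congr_fun measurableSet_Ioc fun x hx => by simp only [abs_of_pos hx.1]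

/-- Only the upper half `[h / 2, h]` is kept; there the gauge is at least `φ(h) / 2`, because `φ(x)
/ x` decreases. -/
lemma le_cubeAvg_zero_logWeight_rpow_neg {t h : ℝ} (ht : 0 ≤ t) (hh : 0 < h) :
    ENNReal.ofReal ((logGauge h / 2) ^ t / 2) ≤
      cubeAvg 0 h (fun y => logWeight y ^ (-t)) := by
  have hφ := logGauge_pos hh
  have e : (fun y => logWeight y ^ (-t)) =
      fun y => (logGauge |y 0|)⁻¹ ^ (-t) := funext fun y => by rw [logWeight_eq]
  rw [e, cubeAvg_eq_div 0 h fun x => (logGauge |x|)⁻¹ ^ (-t), ENNReal.le_div_iff_mul_le (Or.inl (by simpa using hh))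
    (Or.inl ENNReal.ofReal_ne_top)]
  calc ENNReal.ofReal ((logGauge h / 2) ^ t / 2) * ENNReal.ofReal h
      = ∫⁻ x in Set.Icc (h / 2) h, ENNReal.ofReal ((logGauge h / 2) ^ t) := by
        rw [setLIntegral_const, Real.volume_Icc, ← ENNReal.ofReal_mul (by positivity),
          ← ENNReal.ofReal_mul (by positivity)]
        congr 1; ring
    _ ≤ ∫⁻ x in Set.Icc (h / 2) h, ENNReal.ofReal ((logGauge |x|)⁻¹ ^ (-t)) := by
        refine setLIntegral_mono' measurableSet_Icc fun x hx => ?_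
        have hx0 : 0 < x := by linarith [hx.1]
        have hφx := logGauge_pos hx0
        rw [abs_of_pos hx0, Real.inv_rpow hφx.le, ← Real.rpow_neg hφx.le, neg_neg]
        refine ENNReal.ofReal_le_ofReal (Real.rpow_le_rpow (by positivity) ?_ ht)
        refine le_trans ?_ (div_mul_logGauge_le hx0 hx.2)
        rw [div_mul_eq_mul_div, div_le_div_iff₀ two_pos hh]
        nlinarith [hx.1]
    _ ≤ _ := lintegral_mono_set
        (Set.Icc_subset_Icc (by simp only [Pi.zero_apply]; linarith) (by simp))

theorem not_isAinfty_logWeight : ¬ IsAinfty logWeight := by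
  rintro ⟨q, hq, -, hK⟩
  have hq1 : 0 < q - 1 := by linarith
  set K := (apConst q logWeight).toReal
  -- The average of `w_1` over `[0, h]` is `(1 - log h) / φ(h)`, and the dual factor is at least
  -- `φ(h) / (2 * 2 ^ (q - 1))`, so the gauge cancels.
  have key : ∀ h : ℝ, 0 < h → h ≤ 1 → 1 - Real.log h ≤ K * (2 * 2 ^ (q - 1)) := fun h hh h1 => by
    have hφ := logGauge_pos hh
    have hlog := one_le_one_sub_log hh h1
    have hle := le_apConst q logWeight 0 hh
    rw [cubeAvg_zero_logWeight hh h1, one_sub_conjExponent hq] at hle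
    have h2 := (mul_le_mul_right (ENNReal.rpow_le_rpow
      (le_cubeAvg_zero_logWeight_rpow_neg (inv_pos.2 hq1).le hh) hq1.le) _).trans hle
    rw [ENNReal.ofReal_rpow_of_nonneg (by positivity) hq1.le,
      ← ENNReal.ofReal_mul (by positivity),
      ENNReal.ofReal_le_iff_le_toReal hK.ne, Real.div_rpow (by positivity) two_pos.le,
      ← Real.rpow_mul (by positivity), inv_mul_cancel₀ hq1.ne', Real.rpow_one,
      logGauge_of_le_one h1] at h2
    have h3 : (0 : ℝ) < 2 * 2 ^ (q - 1) := by positivity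
    rw [← div_le_iff₀ h3]
    refine le_trans (le_of_eq ?_) h2
    have : 1 - Real.log h ≠ 0 := by linarith
    field_simp
  have hC : 0 ≤ K * (2 * 2 ^ (q - 1)) := by positivity
  -- For this `h` the inequality reads `1 + C ≤ C`, with `C` the right-hand side of `key`.
  have := key (Real.exp (-(K * (2 * 2 ^ (q - 1))))) (Real.exp_pos _)
    (Real.exp_le_one_iff.2 (by linarith))
  rw [Real.log_exp] at this
  linarith

lemma locallyIntegrable_inv_logGauge_abs :
    LocallyIntegrable (fun x : ℝ => (logGauge |x|)⁻¹) volume := by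
  obtain ⟨hint, -⟩ := integrableOn_integral_inv_logGauge one_pos le_rfl
  have hmeas : Measurable fun x : ℝ => (logGauge |x|)⁻¹ :=
    (measurable_logGauge.comp measurable_id.abs).inv
  have hnear : IntegrableOn (fun x : ℝ => (logGauge |x|)⁻¹) (Set.Icc (-1) 1) := by
    refine ⟨hmeas.aestronglyMeasurable, ?_⟩
    rw [hasFiniteIntegral_iff_enorm]
    refine (setLIntegral_comp_abs_le (fun x => ‖(logGauge x)⁻¹‖ₑ) 1).trans_lt ?_
    exact ENNReal.mul_lt_top ENNReal.ofNat_lt_top hint.2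
  have hfar : LocallyIntegrable ((Set.Icc (-1 : ℝ) 1)ᶜ.indicator fun _ => (1 : ℝ)) volume :=
    (locallyIntegrable_const 1).indicator measurableSet_Icc.compl
  have e : (fun x : ℝ => (logGauge |x|)⁻¹) =
      (Set.Icc (-1) 1).indicator (fun x : ℝ => (logGauge |x|)⁻¹) +
        (Set.Icc (-1 : ℝ) 1)ᶜ.indicator fun _ => (1 : ℝ) := by
    conv_lhs => rw [← Set.indicator_self_add_compl (Set.Icc (-1) 1) fun x : ℝ => (logGauge |x|)⁻¹]
    congr 1
    refine Set.indicator_congr fun x hx => ?_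
    rw [logGauge_of_one_lt (lt_of_not_ge fun hle => hx (abs_le.1 hle)), inv_one]
  rw [e]
  exact ((integrable_indicator_iff measurableSet_Icc).2 hnear).locallyIntegrable.add hfar

theorem locallyIntegrable_logPair (i : Fin 2) : LocallyIntegrable (logPair i) volume := by
  fin_cases i
  · have h := locallyIntegrable_inv_logGauge_abs
    rw [← measurePreserving_eval_zero.map_eq] at h
    have e : logWeight = (fun x : ℝ => (logGauge |x|)⁻¹) ∘ Homeomorph.funUnique (Fin 1) ℝ :=
      funext logWeight_eq
    change LocallyIntegrable logWeight volume
    rw [e]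
    exact (locallyIntegrable_map_homeomorph (Homeomorph.funUnique (Fin 1) ℝ)).1 h
  · exact locallyIntegrable_const 1

end LogWeight

end Muckenhoupt

theorem mainTheorem4 :
    (∀ (n m : ℕ) (p : Fin m → ℝ) (_ : ∀ i, 1 < p i) (w : Fin m → (Fin n → ℝ) → ℝ),
      Muckenhoupt.IsMultiAp p w → (∀ i, Muckenhoupt.IsAinfty (w i)) →
        Muckenhoupt.IsProductAp p w) ∧
    (∀ (p : Fin 2 → ℝ) (_ : ∀ i, 1 < p i),
      Muckenhoupt.IsMultiAp p Muckenhoupt.logPair ∧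
      (∀ i, LocallyIntegrable (Muckenhoupt.logPair i) volume) ∧
      ¬ Muckenhoupt.IsAinfty (Muckenhoupt.logPair 0) ∧
      ¬ Muckenhoupt.IsAp (p 0) (Muckenhoupt.logPair 0) ∧
      ¬ Muckenhoupt.IsProductAp p Muckenhoupt.logPair) := by
  refine ⟨fun n m p hp w hw hw' => hw.isProductAp hp hw', fun p hp => ?_⟩
  have hAinf := Muckenhoupt.not_isAinfty_logWeight
  exact ⟨Muckenhoupt.isMultiAp_logPair hp, Muckenhoupt.locallyIntegrable_logPair, hAinf,
    fun h => hAinf ⟨p 0, hp 0, h⟩, fun h => hAinf ⟨p 0, hp 0, h 0⟩⟩
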